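/- Let $F$ be a nonarchimedean local field of characteristic different from $2$, with ring of integers $\mathfrak{o}$ and maximal ideal $\mathfrak{p}$. Let $V$ be a $2$-dimensional vector space over $F$ with a nondegenerate symmetric bilinear form $b$, and put $q(v) = b(v,v)$. Let $\ddagger$ be the involution of $\mathrm{End}(V)$ determined by $b(v,\sigma w) = b(\sigma^\ddagger v, w)$ for all $v,w \in V$, and let $\mathrm{disc}(\ddagger) = \det(h)\cdot (F^\times)^2$, where $h$ is any nonzero element of $\mathrm{End}(V)$ with $h^\ddagger = -h$. For $\alpha \in F$ let the quadratic defect $\mathfrak{d}(\alpha)$ be the intersection of the ideals $\xi\mathfrak{o}$ over all $\eta,\xi \in F$ with $\alpha = \eta^2 + \xi$, and let $\mathfrak{d}(-\mathrm{disc}(\ddagger)\cap\mathfrak{o})$ be the union of the ideals $\mathfrak{d}(\alpha)$ over all $\alpha \in \mathfrak{o}$ with $-\alpha \in \mathrm{disc}(\ddagger)$. A lattice in $V$ is a finitely generated $\mathfrak{o}$-submodule that spans $V$ over $F$. For a lattice $\Lambda$ put $\Lambda^\sharp = \{v \in V : b(v,\Lambda) \subseteq \mathfrak{o}\}$ and $\mathrm{End}(\Lambda)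 = \{\sigma \in \mathrm{End}(V) : \sigma(\Lambda) \subseteq \Lambda\}$, and let $\mathfrak{n}\Lambda$ be the ideal generated by all $q(v)$, $v \in \Lambda$. The lattice $\Lambda$ is maximal if for some nonzero fractional ideal $\mathfrak{a}$ it is $\mathfrak{a}$-maximal, that is, $\mathfrak{n}\Lambda \subseteq \mathfrak{a}$, and $\Lambda' = \Lambda$ for every lattice $\Lambda' \supseteq \Lambda$ with $\mathfrak{n}\Lambda' \subseteq \mathfrak{a}$. Define an equivalence relation on lattices by $\Lambda_1 \sim \Lambda_2$ if and only if $\Lambda_1 = \lambda\Lambda_2$ or $\Lambda_1 = \lambda\Lambda_2^\sharp$ for some $\lambda \in F^\times$. A $\ddagger$-order is an $\mathfrak{o}$-order $\mathcal{O}$ of $\mathrm{End}(V)$ (a subring with $1$ that is an $\mathfrak{o}$-lattice in $\mathrm{End}(V)$) with $\mathcal{O}^\ddagger = \mathcal{O}$; it is a maximal $\ddagger$-order if it is not properly contained in any other $\ddagger$-order. Suppose that either $2 \notin \mathfrak{p}$ or $\mathfrak{d}(-\mathrm{disc}(\ddagger)\cap\mathfrak{o}) = \mathfrak{p}$. Then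 there is a well-defined bijection $$\varphi : \{\text{maximal lattices in } V\}/\!\sim \;\longrightarrow\; \{\text{maximal } \ddagger\text{-orders of } \mathrm{End}(V)\}, \qquad [\Lambda] \longmapsto \mathrm{End}(\Lambda) \cap \mathrm{End}(\Lambda^\sharp).$$ -/

import Mathlib

open ValuativeRel
open scoped Pointwise

namespace DaggerOrders

noncomputable section

/-- Every element of `F` is integral or inverse to an integral element, so
the field is the fraction field of its ring of integers. -/
instance instIsFractionRingIntegers (F : Type*) [Field F] [ValuativeRel F] :
    IsFractionRing 𝒪[F] F :=
  (Valuation.integer.integers (valuation F)).isFractionRing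

section Defect

variable (F : Type*) [Field F] [ValuativeRel F]

/-- The maximal ideal `𝔭` of the ring of integers, as an `𝔬`-submodule of `F`. -/
def maxIdeal : Submodule 𝒪[F] F :=
  IsLocalization.coeSubmodule F (𝓂[F])

variable {F}

/-- The quadratic defect `𝔡(α)` of `α ∈ F`: the intersection of the (fractional) ideals `ξ𝔬` over
all the expressions `α = η ^ 2 + ξ` with `η, ξ ∈ F`. -/
def quadraticDefect (α : F) : Submodule 𝒪[F] F :=
  ⨅ (η : F) (ξ : F) (_ : α = η ^ 2 + ξ), Submodule.span 𝒪[F] {ξ}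

/-- The ideal `𝔡(S)` of a set `S ⊆ F`: the union (equivalently, since ideals of `𝔬` are linearly
ordered, the sum) of the ideals `𝔡(α)` with `α ∈ S`. If `S = -D ∩ 𝔬` with `D` a square class, this
is the defect of an element of `S` of minimal order. -/
def quadraticDefectSet (S : Set F) : Submodule 𝒪[F] F :=
  ⨆ α ∈ S, quadraticDefect α

end Defect

section QuadraticSpace

variable {F : Type*} [Field F] {V : Type*} [AddCommGroup V] [Module F V]

/-- The involution `‡` of `End(V)` attached to `b`, that is, the map with
`b(v, σ w) = b(σ^‡ v, w)` for all `v`, `w`. -/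
def dagger [FiniteDimensional F V] (b : LinearMap.BilinForm F V) (hb : b.Nondegenerate)
    (σ : Module.End F V) : Module.End F V :=
  b.leftAdjointOfNondegenerate hb σ

theorem dagger_spec [FiniteDimensional F V] (b : LinearMap.BilinForm F V) (hb : b.Nondegenerate)
    (σ : Module.End F V) (v w : V) : b v (σ w) = b (dagger b hb σ v) w :=
  (LinearMap.BilinForm.isAdjointPairLeftAdjointOfNondegenerate b hb σ v w).symm

/-- The discriminant of `‡`, a square class of `F`: all `nrd(h) * c ^ 2` with `c ≠ 0` and `h` a
nonzero element of `End(V)` such that `h^‡ = -h`. The reduced norm of `End(V)` is `det`. -/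
def discDagger [FiniteDimensional F V] (b : LinearMap.BilinForm F V) (hb : b.Nondegenerate) :
    Set F :=
  {x | ∃ (h : Module.End F V) (c : F), dagger b hb h = -h ∧ h ≠ 0 ∧ c ≠ 0 ∧
    x = LinearMap.det h * c ^ 2}

variable [ValuativeRel F]

/-- The order `End(Λ)` of all `σ ∈ End(V)` with `σ(Λ) ⊆ Λ`. -/
def endLattice (Λ : Submodule 𝒪[F] V) : Subalgebra 𝒪[F] (Module.End F V) where
  carrier := {σ | ∀ v ∈ Λ, σ v ∈ Λ}
  mul_mem' := fun hσ hτ v hv => hσ _ (hτ v hv)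
  add_mem' := fun hσ hτ v hv => Λ.add_mem (hσ v hv) (hτ v hv)
  algebraMap_mem' := fun r _ hv => Λ.smul_mem r hv

/-- The dual lattice `Λ^♯` of all `v ∈ V` with `b(v, Λ) ⊆ 𝔬`. -/
def dualLattice (b : LinearMap.BilinForm F V) (Λ : Submodule 𝒪[F] V) : Submodule 𝒪[F] V :=
  b.dualSubmodule Λ

/-- The norm `𝔫Λ`: the ideal generated by all `q(v) = b(v, v)` with `v ∈ Λ`. -/
def normIdeal (b : LinearMap.BilinForm F V) (Λ : Submodule 𝒪[F] V) : Submodule 𝒪[F] F :=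
  Submodule.span 𝒪[F] ((fun v => b v v) '' (Λ : Set V))

/-- `Λ` is `𝔞`-maximal: `𝔫Λ ⊆ 𝔞`, and no strictly larger lattice has this property. -/
def IsMaximalAt (b : LinearMap.BilinForm F V) (𝔞 : Submodule 𝒪[F] F)
    (Λ : Submodule 𝒪[F] V) : Prop :=
  normIdeal b Λ ≤ 𝔞 ∧
    ∀ Λ' : Submodule 𝒪[F] V, Submodule.IsLattice F Λ' → Λ ≤ Λ' → normIdeal b Λ' ≤ 𝔞 → Λ = Λ'

/-- The `𝔬`-lattices in `V`: finitely generated `𝔬`-submodules that span `V` over `F`. -/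
abbrev Lattice (F V : Type*) [Field F] [ValuativeRel F] [AddCommGroup V] [Module F V] :=
  {Λ : Submodule 𝒪[F] V // Submodule.IsLattice F Λ}

/-- The maximal lattices in `V`: those that are `𝔞`-maximal for some nonzero fractional
ideal `𝔞` of `F`. -/
abbrev MaximalLattice (b : LinearMap.BilinForm F V) :=
  {Λ : Lattice F V // ∃ 𝔞 : FractionalIdeal (nonZeroDivisors 𝒪[F]) F,
    𝔞 ≠ 0 ∧ IsMaximalAt b (𝔞 : Submodule 𝒪[F] F) Λ.1}

/-- A subring of `End(V)` containing `𝔬` is an order if it is a (full) `𝔬`-lattice in `End(V)`. -/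
def IsOrder (O : Subalgebra 𝒪[F] (Module.End F V)) : Prop :=
  Submodule.IsLattice F (Subalgebra.toSubmodule O)

/-- A `‡`-order is an order `O` with `O^‡ = O`. -/
def IsDaggerOrder [FiniteDimensional F V] (b : LinearMap.BilinForm F V) (hb : b.Nondegenerate)
    (O : Subalgebra 𝒪[F] (Module.End F V)) : Prop :=
  IsOrder O ∧ dagger b hb '' (O : Set (Module.End F V)) = (O : Set (Module.End F V))

/-- The maximal `‡`-orders: the `‡`-orders not properly contained in any other `‡`-order. -/
abbrev MaximalDaggerOrder [FiniteDimensional F V] (b : LinearMap.BilinForm F V)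
    (hb : b.Nondegenerate) :=
  {O : Subalgebra 𝒪[F] (Module.End F V) // Maximal (IsDaggerOrder b hb) O}

/-- The relation `Λ₁ ∼ Λ₂`: there is `c ∈ Fˣ` with `Λ₁ = c Λ₂` or `Λ₁ = c Λ₂^♯`. -/
def LatticeRel (b : LinearMap.BilinForm F V) (Λ₁ Λ₂ : Lattice F V) : Prop :=
  ∃ c : Fˣ, Λ₁.1 = c • Λ₂.1 ∨ Λ₁.1 = c • dualLattice b Λ₂.1

theorem dualLattice_smul (b : LinearMap.BilinForm F V) (c : Fˣ) (Λ : Submodule 𝒪[F] V) :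
    dualLattice b (c • Λ) = c⁻¹ • dualLattice b Λ := by
  ext x
  have hx : x ∈ c⁻¹ • dualLattice b Λ ↔ c • x ∈ dualLattice b Λ := by
    constructor
    · rintro ⟨z, hz, rfl⟩
      change c • (c⁻¹ • z) ∈ dualLattice b Λ
      rwa [smul_inv_smul]
    · intro h
      exact ⟨c • x, h, inv_smul_smul c x⟩
  rw [hx]
  simp only [dualLattice, LinearMap.BilinForm.mem_dualSubmodule]
  constructor
  · intro h y hy
    simpa [Units.smul_def] using h (c • y) (Submodule.smul_mem_pointwise_smul _ _ _ hy)
  · rintro h _ ⟨z, hz, rfl⟩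
    simpa [Units.smul_def] using h z hz

theorem dualLattice_dualLattice [TopologicalSpace F] [IsNonarchimedeanLocalField F]
    [FiniteDimensional F V] {b : LinearMap.BilinForm F V} (hb : b.Nondegenerate) (hs : b.IsSymm)
    (Λ : Lattice F V) : dualLattice b (dualLattice b Λ.1) = Λ.1 := by
  obtain ⟨Λ, hΛ⟩ := Λ
  have : Module.Free 𝒪[F] Λ := Submodule.IsLattice.free F Λ
  let e := Module.Free.chooseBasis 𝒪[F] Λ
  have key : Submodule.span 𝒪[F] (Set.range (e.extendOfIsLattice F)) = Λ := by
    have h1 : Set.range (e.extendOfIsLattice F) = Λ.subtype '' Set.range e := by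
      rw [← Set.range_comp]
      congr 1
      ext i
      simp
    rw [h1, Submodule.span_image, e.span_eq, Submodule.map_top, Submodule.range_subtype]
  have := LinearMap.BilinForm.dualSubmodule_dualSubmodule_of_basis (R := 𝒪[F]) (B := b) hb hs
    (e.extendOfIsLattice F)
  rw [key] at this
  exact this

/-- `∼` is an equivalence relation on the lattices in `V`. -/
def latticeSetoid [TopologicalSpace F] [IsNonarchimedeanLocalField F]
    [FiniteDimensional F V] (b : LinearMap.BilinForm F V) (hb : b.Nondegenerate)
    (hs : b.IsSymm) : Setoid (Lattice F V) where
  r := LatticeRel b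
  iseqv :=
    { refl := fun Λ => ⟨1, Or.inl (one_smul _ _).symm⟩
      symm := by
        rintro Λ₁ Λ₂ ⟨c, h | h⟩
        · exact ⟨c⁻¹, Or.inl (by rw [h, inv_smul_smul])⟩
        · refine ⟨c, Or.inr ?_⟩
          rw [h, dualLattice_smul, dualLattice_dualLattice hb hs, smul_inv_smul]
      trans := by
        rintro Λ₁ Λ₂ Λ₃ ⟨c, h | h⟩ ⟨d, h' | h'⟩
        · exact ⟨c * d, Or.inl (by rw [h, h', mul_smul])⟩
        · exact ⟨c * d, Or.inr (by rw [h, h', mul_smul])⟩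
        · exact ⟨c * d⁻¹, Or.inr (by rw [h, h', dualLattice_smul, mul_smul])⟩
        · exact ⟨c * d⁻¹, Or.inl (by
            rw [h, h', dualLattice_smul, dualLattice_dualLattice hb hs, mul_smul])⟩ }

/-- The restriction of `∼` to the maximal lattices in `V`. -/
def maximalLatticeSetoid [TopologicalSpace F] [IsNonarchimedeanLocalField F]
    [FiniteDimensional F V] (b : LinearMap.BilinForm F V) (hb : b.Nondegenerate)
    (hs : b.IsSymm) : Setoid (MaximalLattice b) :=
  (latticeSetoid b hb hs).comap Subtype.val

end QuadraticSpace

end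

end DaggerOrders

/-! The hypothesis enters only through `normEqScale`: the values `q(v)` on a lattice generate the
same ideal as all the `b(v, w)`. If `2` is a unit this is polarization; otherwise a failure would
put `-disc` in the class of some `1 - p²ε` and push the defect into `𝔭²`. So maximality becomes
maximality under `Λ ≤ aΛ^♯`.

Write `N = aΛ^♯`. If `Λ` is maximal in this sense, then `pN ⊆ Λ ⊆ N`, since otherwise some `Λ +
p^(k+1)N` would be a larger integral lattice. Adjusting `a` makes the first inclusion proper
(`IsAlmostModular`). As `N/pN` is a plane over the residue field, nothing lies strictly between `Λ`
and `N` (`IsUniformizer.eq_or_eq_of_le`); this also gives the converse, so that maximal and almost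
modular lattices coincide.

The core is `IsAlmostModular.eq_smul_or_eq_smul`: `End(Λ) ∩ End(Λ^♯)` contains every map `N → Λ`, in
particular enough rank one maps to force `Λ ⊆ cM ⊆ N` for a suitable multiple of any stable lattice
`M`. Hence `M` is a multiple of `Λ` or `Λ^♯`. This yields injectivity and the maximality of the
order. Surjectivity holds because each `‡`-order acts on a lattice maximal among its integral stable
lattices, and such a lattice is almost modular. -/

namespace DaggerOrders

/-! ### Uniformizers. -/

section Uniformizer

variable {F : Type*} [Field F] [ValuativeRel F]

/-- A unit of `F` that is a uniformizer: it is integral with nonintegral inverse, it divides the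
inverse of each nonintegral element, and its powers clear all denominators. -/
structure IsUniformizer (p : Fˣ) : Prop where
  mem : (p : F) ∈ 𝒪[F]
  inv_notMem : ((p⁻¹ : Fˣ) : F) ∉ 𝒪[F]
  dvd_inv : ∀ x : F, x ∉ 𝒪[F] → (p : F)⁻¹ * x⁻¹ ∈ 𝒪[F]
  exists_pow_mul_mem : ∀ x : F, ∃ n : ℕ, (p : F) ^ n * x ∈ 𝒪[F]

theorem inv_mem_of_notMem {x : F} (hx : x ∉ 𝒪[F]) : x⁻¹ ∈ 𝒪[F] := by
  rw [Valuation.mem_integer_iff] at hx ⊢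
  rw [map_inv₀]
  exact inv_le_one_of_one_le₀ (not_le.mp hx).le

theorem exists_isUniformizer (F : Type*) [Field F] [ValuativeRel F] [TopologicalSpace F]
    [IsNonarchimedeanLocalField F] :
    ∃ p : Fˣ, IsUniformizer p ∧ ∃ r : 𝒪[F], Irreducible r ∧ (r : F) = p := by
  obtain ⟨r, hr⟩ := IsDiscreteValuationRing.exists_irreducible 𝒪[F]
  have hr0 : (r : F) ≠ 0 := by
    simpa using hr.ne_zero
  refine ⟨Units.mk0 r hr0, ⟨r.2, ?_, ?_, ?_⟩, r, hr, rfl⟩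
  · intro h
    refine hr.not_isUnit (IsUnit.of_mul_eq_one ⟨_, h⟩ (Subtype.ext ?_))
    simp [hr0]
  · intro x hx
    have hxi := inv_mem_of_notMem hx
    have hx0 : x ≠ 0 := by rintro rfl; exact hx (zero_mem _)
    have hm : (⟨x⁻¹, hxi⟩ : 𝒪[F]) ∈ IsLocalRing.maximalIdeal 𝒪[F] := by
      rw [IsLocalRing.mem_maximalIdeal, mem_nonunits_iff]
      intro hu
      obtain ⟨y, hy⟩ := hu.exists_right_inv
      have h1 : x⁻¹ * (y : F) = 1 := congrArg Subtype.val hy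
      have : (y : F) = x := by
        field_simp at h1
        exact h1
      exact hx (this ▸ y.2)
    rw [hr.maximalIdeal_eq, Ideal.mem_span_singleton] at hm
    obtain ⟨c, hc⟩ := hm
    have hc' : x⁻¹ = (r : F) * c := congrArg Subtype.val hc
    have : (r : F)⁻¹ * x⁻¹ = c := by rw [hc', inv_mul_cancel_left₀ hr0]
    rw [Units.val_mk0, this]
    exact c.2
  · intro x
    obtain ⟨y, z, hz, rfl⟩ := IsFractionRing.div_surjective (A := 𝒪[F]) x
    have hz0 : z ≠ 0 := nonZeroDivisors.ne_zero hz
    obtain ⟨n, u, hu⟩ := IsDiscreteValuationRing.associated_pow_irreducible hz0 hr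
    refine ⟨n, ?_⟩
    have hz' : (z : F) ≠ 0 := by simpa using hz0
    have h : (z : F) * ((u : 𝒪[F]) : F) = (r : F) ^ n := by
      have := congrArg Subtype.val hu
      simpa using this
    have : ((Units.mk0 (r : F) hr0 : Fˣ) : F) ^ n * (algebraMap 𝒪[F] F y / algebraMap 𝒪[F] F z)
        = ((u * y : 𝒪[F]) : F) := by
      change (r : F) ^ n * ((y : F) / (z : F)) = (u : 𝒪[F]) * (y : F)
      rw [← h]; field_simp
    rw [this]
    exact (u * y : 𝒪[F]).2

end Uniformizer

/-! ### Lattices, duals and chains between `pN` and `N`. -/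

section Lattices

variable {F : Type*} [Field F] [ValuativeRel F] {V : Type*} [AddCommGroup V] [Module F V]

theorem mem_units_smul_iff {c : Fˣ} {Λ : Submodule 𝒪[F] V} {x : V} :
    x ∈ c • Λ ↔ (c : F)⁻¹ • x ∈ Λ := by
  constructor
  · rintro ⟨z, hz, rfl⟩
    change (c : F)⁻¹ • ((c : F) • z) ∈ Λ
    rwa [inv_smul_smul₀ c.ne_zero]
  · intro h
    exact ⟨(c : F)⁻¹ • x, h, smul_inv_smul₀ c.ne_zero x⟩

theorem smul_mem_of_mem {Λ : Submodule 𝒪[F] V} {r : F} (hr : r ∈ 𝒪[F]) {x : V} (hx : x ∈ Λ) :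
    r • x ∈ Λ :=
  Λ.smul_mem ⟨r, hr⟩ hx

theorem mem_dualLattice {b : LinearMap.BilinForm F V} {Λ : Submodule 𝒪[F] V} {x : V} :
    x ∈ dualLattice b Λ ↔ ∀ y ∈ Λ, b x y ∈ 𝒪[F] := by
  refine forall₂_congr fun y _ => ?_
  rw [Submodule.mem_one]
  exact ⟨fun ⟨r, hr⟩ => hr ▸ r.2, fun h => ⟨⟨_, h⟩, rfl⟩⟩

theorem dualLattice_anti {b : LinearMap.BilinForm F V} {Λ M : Submodule 𝒪[F] V} (h : Λ ≤ M) :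
    dualLattice b M ≤ dualLattice b Λ := fun _ hx y hy => hx y (h hy)

theorem le_smul_dualLattice_iff {b : LinearMap.BilinForm F V} {Λ : Submodule 𝒪[F] V} {a : Fˣ} :
    Λ ≤ a • dualLattice b Λ ↔ ∀ x ∈ Λ, ∀ y ∈ Λ, (a : F)⁻¹ * b x y ∈ 𝒪[F] := by
  refine forall₂_congr fun x _ => ?_
  rw [mem_units_smul_iff, mem_dualLattice]
  simp

theorem units_smul_le_of_mem {p : Fˣ} (hp : (p : F) ∈ 𝒪[F]) (Λ : Submodule 𝒪[F] V) :
    p • Λ ≤ Λ := by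
  intro x hx
  rw [mem_units_smul_iff] at hx
  simpa using smul_mem_of_mem hp hx

theorem units_smul_le_smul_iff {c : Fˣ} {Λ M : Submodule 𝒪[F] V} : c • Λ ≤ c • M ↔ Λ ≤ M := by
  refine ⟨fun h x hx => ?_, fun h x hx => ?_⟩
  · have hc : (c : F) • x ∈ c • Λ := by simpa [mem_units_smul_iff] using hx
    simpa [mem_units_smul_iff] using h hc
  · rw [mem_units_smul_iff] at hx ⊢
    exact h hx

theorem exists_isLattice (F V : Type*) [Field F] [ValuativeRel F] [AddCommGroup V] [Module F V]
    [FiniteDimensional F V] : ∃ L : Submodule 𝒪[F] V, Submodule.IsLattice F L := by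
  let e := Module.finBasis F V
  refine ⟨Submodule.span 𝒪[F] (Set.range e), ⟨Submodule.fg_span (Set.finite_range _), ?_⟩⟩
  rw [Submodule.span_span_of_tower, e.span_eq]

theorem IsUniformizer.exists_pow_smul_mem {p : Fˣ} (hp : IsUniformizer p)
    (Λ : Submodule 𝒪[F] V) [hΛ : Submodule.IsLattice F Λ] (x : V) :
    ∃ n : ℕ, (p : F) ^ n • x ∈ Λ := by
  have hx : x ∈ Submodule.span F (Λ : Set V) := by
    rw [hΛ.span_eq_top]; trivial
  induction hx using Submodule.span_induction with
  | mem x h => exact ⟨0, by simpa using h⟩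
  | zero => exact ⟨0, by simp⟩
  | add x y _ _ hx hy =>
    obtain ⟨n, hn⟩ := hx
    obtain ⟨m, hm⟩ := hy
    refine ⟨n + m, ?_⟩
    rw [smul_add]
    refine add_mem ?_ ?_
    · rw [pow_add, mul_comm, mul_smul]
      exact smul_mem_of_mem (pow_mem hp.mem m) hn
    · rw [pow_add, mul_smul]
      exact smul_mem_of_mem (pow_mem hp.mem n) hm
  | smul r x _ hx =>
    obtain ⟨n, hn⟩ := hx
    obtain ⟨m, hm⟩ := hp.exists_pow_mul_mem r
    refine ⟨m + n, ?_⟩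
    have : (p : F) ^ (m + n) • r • x = ((p : F) ^ m * r) • (p : F) ^ n • x := by
      rw [smul_smul, smul_smul]; congr 1; ring
    rw [this]
    exact smul_mem_of_mem hm hn

theorem IsUniformizer.exists_pow_smul_le {p : Fˣ} (hp : IsUniformizer p)
    (Λ : Submodule 𝒪[F] V) [Submodule.IsLattice F Λ] {M : Submodule 𝒪[F] V} (hM : M.FG) :
    ∃ n : ℕ, p ^ n • M ≤ Λ := by
  have key : ∃ n : ℕ, ∀ x ∈ M, (p : F) ^ n • x ∈ Λ := by
    induction M, hM using Submodule.fg_induction with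
    | singleton x =>
      obtain ⟨n, hn⟩ := hp.exists_pow_smul_mem Λ x
      refine ⟨n, fun y hy => ?_⟩
      obtain ⟨r, rfl⟩ := Submodule.mem_span_singleton.mp hy
      rw [smul_comm]
      exact Λ.smul_mem r hn
    | sup M N hM hN hM' hN' =>
      obtain ⟨n, hn⟩ := hM'
      obtain ⟨m, hm⟩ := hN'
      refine ⟨n + m, fun x hx => ?_⟩
      obtain ⟨y, hy, z, hz, rfl⟩ := Submodule.mem_sup.mp hx
      rw [smul_add]
      refine add_mem ?_ ?_
      · rw [pow_add, mul_comm, mul_smul]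
        exact smul_mem_of_mem (pow_mem hp.mem m) (hn y hy)
      · rw [pow_add, mul_smul]
        exact smul_mem_of_mem (pow_mem hp.mem n) (hm z hz)
  obtain ⟨n, hn⟩ := key
  refine ⟨n, fun x hx => ?_⟩
  rw [mem_units_smul_iff] at hx
  simpa [smul_smul] using hn _ hx

theorem isLattice_dualLattice [TopologicalSpace F] [IsNonarchimedeanLocalField F]
    [FiniteDimensional F V] {b : LinearMap.BilinForm F V} (hb : b.Nondegenerate)
    (Λ : Submodule 𝒪[F] V) [Submodule.IsLattice F Λ] :
    Submodule.IsLattice F (dualLattice b Λ) := by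
  classical
  have : Module.Free 𝒪[F] Λ := Submodule.IsLattice.free F Λ
  let e := Module.Free.chooseBasis 𝒪[F] Λ
  have key : Submodule.span 𝒪[F] (Set.range (e.extendOfIsLattice F)) = Λ := by
    have h1 : Set.range (e.extendOfIsLattice F) = Λ.subtype '' Set.range e := by
      rw [← Set.range_comp]
      congr 1
      ext i
      simp
    rw [h1, Submodule.span_image, e.span_eq, Submodule.map_top, Submodule.range_subtype]
  have h := LinearMap.BilinForm.dualSubmodule_span_of_basis (R := 𝒪[F]) (B := b) hb
    (e.extendOfIsLattice F)
  rw [key] at h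
  unfold dualLattice
  rw [h]
  refine ⟨Submodule.fg_span (Set.finite_range _), ?_⟩
  rw [Submodule.span_span_of_tower, Module.Basis.span_eq]

/-- Each lattice is contained in a multiple of its dual. -/
theorem exists_le_smul_dualLattice [TopologicalSpace F] [IsNonarchimedeanLocalField F]
    [FiniteDimensional F V] {b : LinearMap.BilinForm F V} (hb : b.Nondegenerate)
    {p : Fˣ} (hp : IsUniformizer p) (Λ : Submodule 𝒪[F] V) [hΛ : Submodule.IsLattice F Λ] :
    ∃ a : Fˣ, Λ ≤ a • dualLattice b Λ := by
  have := isLattice_dualLattice hb Λ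
  obtain ⟨n, hn⟩ := hp.exists_pow_smul_le (dualLattice b Λ) hΛ.fg
  refine ⟨(p ^ n)⁻¹, ?_⟩
  rw [← units_smul_le_smul_iff (c := p ^ n), smul_inv_smul]
  exact hn

/-- Between `p N` and `N` there is no chain of two proper inclusions of further modules. -/
theorem IsUniformizer.eq_or_eq_of_le {p : Fˣ} (hp : IsUniformizer p)
    (hdim : Module.finrank F V = 2) {Λ M N : Submodule 𝒪[F] V} (h : p • N < Λ) (hM : Λ ≤ M)
    (hN : M ≤ N) : M = Λ ∨ M = N := by
  by_contra! hne
  obtain ⟨l, hl, hl'⟩ := SetLike.exists_of_lt h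
  obtain ⟨m, hm, hm'⟩ := SetLike.exists_of_lt (lt_of_le_of_ne hM (Ne.symm hne.1))
  -- An element of `F` is divisible by `p` unless its inverse is integral.
  have dvd : ∀ x : F, ¬(x ≠ 0 ∧ x⁻¹ ∈ 𝒪[F]) → (p : F)⁻¹ * x ∈ 𝒪[F] := by
    intro x hx
    by_cases hx0 : x = 0
    · simp [hx0]
    · simpa using hp.dvd_inv x⁻¹ fun h => hx ⟨hx0, h⟩
  -- Independence of `l` and `m` modulo `pN`: a unit coefficient would put `m` into `Λ` or `l` into
  -- `pN`.
  have res : ∀ x y : F, x ∈ 𝒪[F] → x • l + y • m ∈ p • N →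
      (p : F)⁻¹ * x ∈ 𝒪[F] ∧ (p : F)⁻¹ * y ∈ 𝒪[F] := by
    intro x y hx hxy
    have hy : (p : F)⁻¹ * y ∈ 𝒪[F] := by
      refine dvd y fun ⟨hy0, hyi⟩ => hm' ?_
      have h1 : m = y⁻¹ • (x • l + y • m) - (y⁻¹ * x) • l := by
        rw [smul_add, smul_smul, smul_smul, inv_mul_cancel₀ hy0, one_smul, add_sub_cancel_left]
      rw [h1]
      exact sub_mem (smul_mem_of_mem hyi (h.le hxy)) (smul_mem_of_mem (mul_mem hyi hx) hl)
    refine ⟨dvd x fun ⟨hx0, hxi⟩ => hl' ?_, hy⟩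
    have h1 : l = x⁻¹ • ((x • l + y • m) - y • m) := by
      rw [add_sub_cancel_right, smul_smul, inv_mul_cancel₀ hx0, one_smul]
    rw [h1]
    refine smul_mem_of_mem hxi (sub_mem hxy ?_)
    rw [mem_units_smul_iff, smul_smul]
    exact smul_mem_of_mem hy (hN hm)
  have hpinv : (p : F)⁻¹ * 1 ∉ 𝒪[F] := by simpa using hp.inv_notMem
  -- Dividing by a nonintegral coefficient lands in `pN` and makes that coefficient `1`, which `res`
  -- excludes. So `l` and `m` will generate `N`.
  have scale : ∀ c x y : F, c ∉ 𝒪[F] → x • l + y • m ∈ N →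
      (c⁻¹ * x) • l + (c⁻¹ * y) • m ∈ p • N := by
    intro c x y hc hxy
    have := smul_mem_of_mem (hp.dvd_inv c hc) hxy
    rw [mem_units_smul_iff]
    simpa [smul_add, smul_smul, mul_assoc] using this
  have left : ∀ x y : F, x • l + y • m ∈ N → x ∉ 𝒪[F] → y ∈ 𝒪[F] → False := by
    intro x y hxy hx hy
    have hx0 : x ≠ 0 := by rintro rfl; exact hx (zero_mem _)
    have := scale x x y hx hxy
    rw [inv_mul_cancel₀ hx0] at this
    exact hpinv (res _ _ (one_mem _) this).1
  have key : ∀ x y : F, x • l + y • m ∈ N → x ∈ 𝒪[F] ∧ y ∈ 𝒪[F] := by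
    intro x y hxy
    by_cases hy : y ∈ 𝒪[F]
    · exact ⟨by_contra fun hx => left x y hxy hx hy, hy⟩
    exfalso
    have hy0 : y ≠ 0 := by rintro rfl; exact hy (zero_mem _)
    by_cases hyx : y⁻¹ * x ∈ 𝒪[F]
    · have := scale y x y hy hxy
      rw [inv_mul_cancel₀ hy0] at this
      exact hpinv (res _ _ hyx this).2
    · have := h.le.trans (hM.trans hN) (scale y x y hy hxy)
      rw [inv_mul_cancel₀ hy0] at this
      exact left _ _ this hyx (one_mem _)
  have hli : LinearIndependent F ![l, m] := by
    rw [LinearIndependent.pair_iff]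
    intro x y hxy
    -- All multiples of the zero vector lie in `N`, so every multiple of `x` and `y` is integral,
    -- which forces both to vanish.
    have big : ∀ c : F, c * x ∈ 𝒪[F] ∧ c * y ∈ 𝒪[F] := by
      intro c
      refine key _ _ ?_
      rw [mul_smul, mul_smul, ← smul_add, hxy, smul_zero]
      exact zero_mem _
    constructor
    · by_contra h0
      have := (big ((p : F)⁻¹ * x⁻¹)).1
      rw [mul_assoc, inv_mul_cancel₀ h0] at this
      exact hpinv this
    · by_contra h0
      have := (big ((p : F)⁻¹ * y⁻¹)).2
      rw [mul_assoc, inv_mul_cancel₀ h0] at this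
      exact hpinv this
  have : FiniteDimensional F V := Module.finite_of_finrank_pos (by omega)
  have hsp := hli.span_eq_top_of_card_eq_finrank' (by simp [hdim])
  refine hne.2 (le_antisymm hN fun n hn => ?_)
  have hn' : n ∈ Submodule.span F (Set.range ![l, m]) := by rw [hsp]; trivial
  rw [Matrix.range_cons, Matrix.range_cons, Matrix.range_empty, Set.union_empty,
    Set.singleton_union, Submodule.mem_span_pair] at hn'
  obtain ⟨x, y, rfl⟩ := hn'
  obtain ⟨hx, hy⟩ := key x y hn
  exact add_mem (smul_mem_of_mem hx (hM hl)) (smul_mem_of_mem hy hm)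

end Lattices

/-! ### Skew endomorphisms and the discriminant of the involution. -/

section Dagger

variable {F : Type*} [Field F] {V : Type*} [AddCommGroup V] [Module F V] [FiniteDimensional F V]
  {b : LinearMap.BilinForm F V}

theorem dagger_eq_of_forall (hb : b.Nondegenerate) {σ τ : Module.End F V}
    (h : ∀ v w, b v (σ w) = b (τ v) w) : dagger b hb σ = τ := by
  ext v
  rw [← sub_eq_zero]
  refine hb.1 _ fun w => ?_
  rw [map_sub, LinearMap.sub_apply, ← dagger_spec, h, sub_self]

theorem dagger_dagger (hb : b.Nondegenerate) (hs : b.IsSymm) (σ : Module.End F V) :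
    dagger b hb (dagger b hb σ) = σ :=
  dagger_eq_of_forall hb fun v w => by
    calc b v (dagger b hb σ w) = b (dagger b hb σ w) v := hs.eq _ _
      _ = b w (σ v) := (dagger_spec b hb σ w v).symm
      _ = b (σ v) w := hs.eq _ _

omit [FiniteDimensional F V] in
theorem linearIndependent_pair_of_gram_ne_zero (hs : b.IsSymm) {x y : V}
    (hD : b x x * b y y - b x y ^ 2 ≠ 0) : LinearIndependent F ![x, y] := by
  rw [LinearIndependent.pair_iff]
  intro s t hst
  have hyx : b y x = b x y := hs.eq y x
  have h1 : s * b x x + t * b x y = 0 := by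
    have := congrArg (b x) hst
    simpa using this
  have h2 : s * b x y + t * b y y = 0 := by
    have := congrArg (b y) hst
    simpa [hyx] using this
  constructor
  · have : s * (b x x * b y y - b x y ^ 2) = 0 := by linear_combination b y y * h1 - b x y * h2
    exact (mul_eq_zero.mp this).resolve_right hD
  · have : t * (b x x * b y y - b x y ^ 2) = 0 := by linear_combination b x x * h2 - b x y * h1
    exact (mul_eq_zero.mp this).resolve_right hD

/-- The skew endomorphism `v ↦ b(x, v) y - b(y, v) x`. -/
def skewEnd (b : LinearMap.BilinForm F V) (x y : V) : Module.End F V :=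
  (b x).smulRight y - (b y).smulRight x

omit [FiniteDimensional F V] in
theorem skewEnd_apply (x y v : V) : skewEnd b x y v = b x v • y - b y v • x := rfl

theorem dagger_skewEnd (hb : b.Nondegenerate) (hs : b.IsSymm) (x y : V) :
    dagger b hb (skewEnd b x y) = -skewEnd b x y := by
  refine dagger_eq_of_forall hb fun v w => ?_
  have hvx : b v x = b x v := hs.eq v x
  have hvy : b v y = b y v := hs.eq v y
  simp only [LinearMap.neg_apply, skewEnd_apply, map_sub, map_smul, map_neg, LinearMap.sub_apply,
    LinearMap.smul_apply, smul_eq_mul, hvx, hvy]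
  ring

omit [FiniteDimensional F V] in
theorem det_skewEnd (hdim : Module.finrank F V = 2) (hs : b.IsSymm) {x y : V}
    (hD : b x x * b y y - b x y ^ 2 ≠ 0) :
    LinearMap.det (skewEnd b x y) = b x x * b y y - b x y ^ 2 := by
  let e := basisOfLinearIndependentOfCardEqFinrank
    (linearIndependent_pair_of_gram_ne_zero hs hD) (by simp [hdim])
  have h0 : e 0 = x := by simp [e]
  have h1 : e 1 = y := by simp [e]
  have hyx : b y x = b x y := hs.eq y x
  rw [← LinearMap.det_toMatrix e, Matrix.det_fin_two]
  simp only [LinearMap.toMatrix_apply, skewEnd_apply, h0, h1, hyx]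
  rw [← h0, ← h1]
  simp only [map_sub, map_smul, Module.Basis.repr_self]
  simp
  ring

/-- Since `2 ≠ 0`, the form `(v, w) ↦ b(v, h w)` is alternating, and the alternating forms on a
plane form a line. -/
theorem exists_smul_skewEnd (hdim : Module.finrank F V = 2) (hchar : (2 : F) ≠ 0)
    (hb : b.Nondegenerate) (hs : b.IsSymm) {x y : V}
    (hD : b x x * b y y - b x y ^ 2 ≠ 0) {h : Module.End F V} (hh : dagger b hb h = -h) :
    ∃ t : F, h = t • skewEnd b x y := by
  let e := basisOfLinearIndependentOfCardEqFinrank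
    (linearIndependent_pair_of_gram_ne_zero hs hD) (by simp [hdim])
  have h0 : e 0 = x := by simp [e]
  have h1 : e 1 = y := by simp [e]
  have hyx : b y x = b x y := hs.eq y x
  have skew : ∀ v w, b v (h w) = -b w (h v) := by
    intro v w
    rw [dagger_spec b hb, hh, LinearMap.neg_apply, map_neg, LinearMap.neg_apply]
    congr 1
    exact hs.eq (h v) w
  have alt : ∀ v, b v (h v) = 0 := by
    intro v
    have h2 : 2 * b v (h v) = 0 := by linear_combination skew v v
    exact (mul_eq_zero.mp h2).resolve_left hchar
  have sep : ∀ z, b x z = 0 → b y z = 0 → z = 0 := by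
    intro z hx hy
    refine hb.2 z fun v => ?_
    have : b.flip z = 0 := by
      refine e.ext fun i => ?_
      fin_cases i
      · simpa [h0] using hx
      · simpa [h1] using hy
    exact LinearMap.congr_fun this v
  have hD' : b x y ^ 2 - b x x * b y y ≠ 0 := fun h => hD (by linear_combination -h)
  -- The denominator is `b x (skewEnd b x y y)`, so the scalar is read off by comparing values at
  -- `(x, y)`.
  refine ⟨b x (h y) / (b x y ^ 2 - b x x * b y y), e.ext fun i => ?_⟩
  rw [← sub_eq_zero]
  have hxy := skew y x
  fin_cases i
  · change h (e 0) - (_ • skewEnd b x y) (e 0) = 0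
    rw [h0]
    apply sep
    · simp [skewEnd_apply, alt, hyx]
      right; ring
    · simp [skewEnd_apply, hyx, hxy]
      field_simp
      ring
  · change h (e 1) - (_ • skewEnd b x y) (e 1) = 0
    rw [h1]
    apply sep
    · simp [skewEnd_apply]
      field_simp
      ring
    · simp [skewEnd_apply, alt, hyx]
      right; ring

theorem mem_neg_discDagger_iff (hdim : Module.finrank F V = 2) (hchar : (2 : F) ≠ 0)
    (hb : b.Nondegenerate) (hs : b.IsSymm) {x y : V}
    (hD : b x x * b y y - b x y ^ 2 ≠ 0) {α : F} :
    α ∈ -discDagger b hb ↔ ∃ c : F, c ≠ 0 ∧ α = (b x y ^ 2 - b x x * b y y) * c ^ 2 := by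
  rw [Set.mem_neg]
  constructor
  · rintro ⟨h, c, hh, hne, hc, hα⟩
    obtain ⟨t, rfl⟩ := exists_smul_skewEnd hdim hchar hb hs hD hh
    have ht : t ≠ 0 := by rintro rfl; simp at hne
    refine ⟨t * c, mul_ne_zero ht hc, ?_⟩
    rw [LinearMap.det_smul, det_skewEnd hdim hs hD, hdim] at hα
    linear_combination -hα
  · rintro ⟨c, hc, rfl⟩
    refine ⟨skewEnd b x y, c, dagger_skewEnd hb hs x y, ?_, hc, ?_⟩
    · intro h0
      have := det_skewEnd hdim hs hD
      rw [h0, LinearMap.det_zero, hdim, zero_pow two_ne_zero] at this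
      exact hD this.symm
    · rw [det_skewEnd hdim hs hD]; ring

end Dagger

/-! ### Norm versus scale under the defect hypothesis. -/

section Norm

variable {F : Type*} [Field F] [ValuativeRel F] [TopologicalSpace F]
  [IsNonarchimedeanLocalField F] {V : Type*} [AddCommGroup V] [Module F V] [FiniteDimensional F V]
  {b : LinearMap.BilinForm F V}

/-- Under the hypothesis on the quadratic defect, polarization does not leave the ideal that
contains the values of the quadratic form. -/
theorem inv_mul_bilin_mem (hchar : (2 : F) ≠ 0) (hdim : Module.finrank F V = 2)
    (hb : b.Nondegenerate) (hs : b.IsSymm)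
    (hF : (2 : 𝒪[F]) ∉ 𝓂[F] ∨
      quadraticDefectSet (-(discDagger b hb) ∩ {x : F | x ∈ 𝒪[F]}) = maxIdeal F)
    {a : F} {x y : V} (hx : a * b x x ∈ 𝒪[F]) (hy : a * b y y ∈ 𝒪[F])
    (hxy : a * b (x + y) (x + y) ∈ 𝒪[F]) : a * b x y ∈ 𝒪[F] := by
  obtain h2 | hF := hF
  · have hu : IsUnit (2 : 𝒪[F]) := by simpa using h2
    obtain ⟨u, hu⟩ := hu.exists_right_inv
    have hu' : 2 * (u : F) = 1 := congrArg Subtype.val hu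
    have hyx : b y x = b x y := hs.eq y x
    have : a * b x y = u * (a * b (x + y) (x + y) - a * b x x - a * b y y) := by
      simp only [map_add, LinearMap.add_apply, hyx]
      linear_combination -(a * b x y) * hu'
    rw [this]
    exact mul_mem u.2 (sub_mem (sub_mem hxy hx) hy)
  by_contra hxy'
  obtain ⟨p, hp, r, hr, hrp⟩ := exists_isUniformizer F
  have hs0 : a * b x y ≠ 0 := fun h => hxy' (h ▸ zero_mem _)
  have ha : a ≠ 0 := left_ne_zero_of_mul hs0
  have hb0 : b x y ≠ 0 := right_ne_zero_of_mul hs0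
  have hp0 : (p : F) ≠ 0 := p.ne_zero
  -- `b(x, x) b(y, y) / b(x, y) ^ 2` is divisible by `p ^ 2`
  obtain ⟨ε, hε, hεe⟩ : ∃ ε ∈ 𝒪[F], b x x * b y y = (p : F) ^ 2 * ε * b x y ^ 2 := by
    have hi := hp.dvd_inv _ hxy'
    refine ⟨_, mul_mem (mul_mem hi hx) (mul_mem hi hy), ?_⟩
    field_simp
  -- Elements of `1 + 𝔭` are units.
  have hunit : ∀ z ∈ 𝒪[F], 1 - (p : F) * z ≠ 0 ∧ (1 - (p : F) * z)⁻¹ ∈ 𝒪[F] := by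
    intro z hz
    have hne : 1 - (p : F) * z ≠ 0 := by
      intro h
      have : ((p⁻¹ : Fˣ) : F) = z := by
        rw [Units.val_inv_eq_inv_val]
        field_simp
        linear_combination h
      exact hp.inv_notMem (this ▸ hz)
    refine ⟨hne, by_contra fun h => hp.inv_notMem ?_⟩
    have h1 := hp.dvd_inv _ h
    rw [inv_inv] at h1
    have : ((p⁻¹ : Fˣ) : F) = (p : F)⁻¹ * (1 - (p : F) * z) + z := by
      rw [Units.val_inv_eq_inv_val]; field_simp; ring
    rw [this]
    exact add_mem h1 hz
  obtain ⟨hβ, hβi⟩ := hunit ((p : F) * ε) (mul_mem hp.mem hε)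
  have hDe : b x y ^ 2 - b x x * b y y = (1 - (p : F) * (p * ε)) * b x y ^ 2 := by
    rw [hεe]; ring
  have hD : b x x * b y y - b x y ^ 2 ≠ 0 := by
    have : b x y ^ 2 - b x x * b y y ≠ 0 := hDe ▸ mul_ne_zero hβ (pow_ne_zero 2 hb0)
    exact fun h => this (by linear_combination -h)
  -- By the Gram determinant, an integral element of `-disc` is `(1 - p²ε)η²` with `η = b(x, y)c`
  -- and `η²` integral. Taking `ξ = -p²εη²` bounds its defect by `𝔭²`, against the assumption that
  -- the defects fill `𝔭`.
  have hle : quadraticDefectSet (-(discDagger b hb) ∩ {x : F | x ∈ 𝒪[F]}) ≤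
      Submodule.span 𝒪[F] {(p : F) ^ 2} := by
    refine iSup₂_le fun α hα => ?_
    obtain ⟨hα, hαO⟩ := hα
    obtain ⟨c, hc, rfl⟩ := (mem_neg_discDagger_iff hdim hchar hb hs hD).mp hα
    have hk2 : (b x y * c) ^ 2 ∈ 𝒪[F] := by
      have : (b x y * c) ^ 2 = (1 - (p : F) * (p * ε))⁻¹ *
          ((b x y ^ 2 - b x x * b y y) * c ^ 2) := by
        rw [hDe, mul_assoc, inv_mul_cancel_left₀ hβ, mul_pow]
      rw [this]
      exact mul_mem hβi hαO
    refine (iInf_le_of_le (b x y * c) (iInf_le_of_le (-(p ^ 2 * (ε * (b x y * c) ^ 2)))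
      (iInf_le _ ?_))).trans ?_
    · rw [hDe]; ring
    · rw [Submodule.span_singleton_le_iff_mem, Submodule.mem_span_singleton]
      refine ⟨⟨_, neg_mem (mul_mem hε hk2)⟩, ?_⟩
      change -(ε * (b x y * c) ^ 2) * (p : F) ^ 2 = _
      ring
  have hmem : (p : F) ∈ maxIdeal F := by
    refine ⟨r, ?_, hrp⟩
    exact (IsLocalRing.mem_maximalIdeal r).mpr hr.not_isUnit
  rw [← hF] at hmem
  obtain ⟨c, hc⟩ := Submodule.mem_span_singleton.mp (hle hmem)
  have hc' : (c : F) * (p : F) ^ 2 = p := hc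
  refine hp.inv_notMem ?_
  have : ((p⁻¹ : Fˣ) : F) = c := by
    rw [Units.val_inv_eq_inv_val]
    field_simp
    have : (p : F) * (c * p - 1) = 0 := by linear_combination hc'
    have := (mul_eq_zero.mp this).resolve_left hp0
    linear_combination -this
  exact this ▸ c.2

end Norm

/-! ### Endomorphism orders and the orders `End(Λ) ∩ End(Λ^♯)`. -/

section Orders

variable {F : Type*} [Field F] [ValuativeRel F] {V : Type*} [AddCommGroup V] [Module F V]

theorem mem_endLattice {Λ : Submodule 𝒪[F] V} {σ : Module.End F V} :
    σ ∈ endLattice Λ ↔ ∀ v ∈ Λ, σ v ∈ Λ := Iff.rfl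

theorem endLattice_smul (c : Fˣ) (Λ : Submodule 𝒪[F] V) :
    endLattice (c • Λ) = endLattice Λ := by
  ext σ
  simp only [mem_endLattice, mem_units_smul_iff]
  refine ⟨fun h v hv => ?_, fun h v hv => ?_⟩
  · simpa using h ((c : F) • v) (by simpa using hv)
  · simpa using h _ hv

/-- The order `End(Λ) ∩ End(Λ^♯)`. -/
noncomputable def pairOrder (b : LinearMap.BilinForm F V) (Λ : Submodule 𝒪[F] V) :
    Subalgebra 𝒪[F] (Module.End F V) :=
  endLattice Λ ⊓ endLattice (dualLattice b Λ)

theorem pairOrder_smul (b : LinearMap.BilinForm F V) (c : Fˣ) (Λ : Submodule 𝒪[F] V) :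
    pairOrder b (c • Λ) = pairOrder b Λ := by
  rw [pairOrder, dualLattice_smul, endLattice_smul, endLattice_smul, pairOrder]

theorem dagger_mem_endLattice_dualLattice [FiniteDimensional F V] {b : LinearMap.BilinForm F V}
    (hb : b.Nondegenerate) {Λ : Submodule 𝒪[F] V} {σ : Module.End F V}
    (hσ : σ ∈ endLattice Λ) : dagger b hb σ ∈ endLattice (dualLattice b Λ) := by
  intro v hv
  rw [mem_dualLattice] at hv ⊢
  intro w hw
  rw [← dagger_spec]
  exact hv _ (hσ w hw)

/-- A `‡`-stable ring of endomorphisms of `Λ` also acts on `Λ^♯`. -/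
theorem le_pairOrder [FiniteDimensional F V] {b : LinearMap.BilinForm F V}
    (hb : b.Nondegenerate) (hs : b.IsSymm) {Λ : Submodule 𝒪[F] V}
    {O : Subalgebra 𝒪[F] (Module.End F V)} (hO : ∀ σ ∈ O, dagger b hb σ ∈ O)
    (h : O ≤ endLattice Λ) : O ≤ pairOrder b Λ := by
  refine le_inf h fun σ hσ => ?_
  rw [← dagger_dagger hb hs σ]
  exact dagger_mem_endLattice_dualLattice hb (h (hO σ hσ))

theorem IsDaggerOrder.dagger_mem [FiniteDimensional F V] {b : LinearMap.BilinForm F V}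
    {hb : b.Nondegenerate} {O : Subalgebra 𝒪[F] (Module.End F V)} (hO : IsDaggerOrder b hb O)
    {σ : Module.End F V} (hσ : σ ∈ O) : dagger b hb σ ∈ O := by
  have : dagger b hb σ ∈ (O : Set (Module.End F V)) := hO.2 ▸ Set.mem_image_of_mem _ hσ
  exact this

variable [TopologicalSpace F] [IsNonarchimedeanLocalField F]

theorem isLattice_endLattice [FiniteDimensional F V] (Λ : Submodule 𝒪[F] V)
    [hΛ : Submodule.IsLattice F Λ] :
    Submodule.IsLattice F (Subalgebra.toSubmodule (endLattice Λ)) := by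
  obtain ⟨p, hp, -⟩ := exists_isUniformizer F
  constructor
  · -- an endomorphism is determined by its values on a finite set of generators of `Λ`
    obtain ⟨s, hs⟩ := hΛ.fg
    have hsΛ : ∀ x ∈ s, x ∈ Λ := fun x hx => hs ▸ Submodule.subset_span hx
    let f : Subalgebra.toSubmodule (endLattice Λ) →ₗ[𝒪[F]] (s → Λ) :=
      { toFun := fun σ x => ⟨σ.1 x, σ.2 x (hsΛ x x.2)⟩
        map_add' := fun _ _ => rfl
        map_smul' := fun _ _ => rfl }
    have hf : Function.Injective f := by
      intro σ τ h
      refine Subtype.ext (LinearMap.ext_on (s := (s : Set V)) ?_ fun x hx => ?_)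
      · rw [← Submodule.span_span_of_tower 𝒪[F] F (s : Set V), hs]
        exact hΛ.span_eq_top
      · exact congrArg Subtype.val (congrFun h ⟨x, hx⟩)
    have : IsNoetherian 𝒪[F] (s → Λ) := inferInstance
    have := isNoetherian_of_injective f hf
    rw [← Module.Finite.iff_fg]
    infer_instance
  · rw [eq_top_iff]
    intro σ _
    have hfg : (Λ.map (σ.restrictScalars 𝒪[F])).FG := hΛ.fg.map _
    obtain ⟨n, hn⟩ := hp.exists_pow_smul_le Λ hfg
    have hmem : (p : F) ^ n • σ ∈ endLattice Λ := by
      intro v hv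
      refine hn ?_
      rw [mem_units_smul_iff]
      simpa using Submodule.mem_map_of_mem (f := σ.restrictScalars 𝒪[F]) hv
    have : σ = ((p : F) ^ n)⁻¹ • ((p : F) ^ n • σ) := by
      rw [inv_smul_smul₀ (pow_ne_zero n p.ne_zero)]
    rw [this]
    exact Submodule.smul_mem _ _ (Submodule.subset_span hmem)

variable [FiniteDimensional F V] {b : LinearMap.BilinForm F V}

theorem pairOrder_dualLattice (hb : b.Nondegenerate) (hs : b.IsSymm) (Λ : Submodule 𝒪[F] V)
    [hΛ : Submodule.IsLattice F Λ] : pairOrder b (dualLattice b Λ) = pairOrder b Λ := by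
  rw [pairOrder, dualLattice_dualLattice hb hs ⟨Λ, hΛ⟩, inf_comm, pairOrder]

theorem isDaggerOrder_pairOrder (hb : b.Nondegenerate) (hs : b.IsSymm) (Λ : Submodule 𝒪[F] V)
    [hΛ : Submodule.IsLattice F Λ] : IsDaggerOrder b hb (pairOrder b Λ) := by
  have hd := isLattice_dualLattice hb Λ
  have h1 := isLattice_endLattice Λ
  have h2 := isLattice_endLattice (dualLattice b Λ)
  have stable : ∀ σ ∈ pairOrder b Λ, dagger b hb σ ∈ pairOrder b Λ := by
    intro σ hσ
    have := dagger_mem_endLattice_dualLattice hb hσ.2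
    rw [dualLattice_dualLattice hb hs ⟨Λ, hΛ⟩] at this
    exact ⟨this, dagger_mem_endLattice_dualLattice hb hσ.1⟩
  refine ⟨?_, Set.Subset.antisymm ?_ fun σ hσ => ⟨_, stable σ hσ, dagger_dagger hb hs σ⟩⟩
  · exact Submodule.IsLattice.inf F (Subalgebra.toSubmodule (endLattice Λ))
      (Subalgebra.toSubmodule (endLattice (dualLattice b Λ)))
  · rintro _ ⟨σ, hσ, rfl⟩
    exact stable σ hσ

omit [TopologicalSpace F] [IsNonarchimedeanLocalField F] in
/-- Each order acts on some lattice. -/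
theorem IsOrder.exists_le_endLattice {O : Subalgebra 𝒪[F] (Module.End F V)} (hO : IsOrder O) :
    ∃ Λ : Submodule 𝒪[F] V, Submodule.IsLattice F Λ ∧ O ≤ endLattice Λ := by
  obtain ⟨L, hL⟩ := exists_isLattice F V
  -- The lattice is `O·L`: it contains `L` because `1 ∈ O`, and is `O`-stable because `O·O ⊆ O`.
  let f : Module.End F V →ₗ[𝒪[F]] V →ₗ[𝒪[F]] V :=
    LinearMap.mk₂ 𝒪[F] (fun σ v => σ v) (fun _ _ _ => rfl) (fun _ _ _ => rfl)
      (fun σ _ _ => map_add σ _ _) (fun r σ v => map_smul σ (r : F) v)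
  have hle : L ≤ Submodule.map₂ f (Subalgebra.toSubmodule O) L := by
    intro v hv
    exact Submodule.apply_mem_map₂ f (m := 1) (one_mem O) hv
  refine ⟨Submodule.map₂ f (Subalgebra.toSubmodule O) L,
    Submodule.IsLattice.of_le_of_isLattice_of_fg F hle (hO.fg.map₂ f hL.fg), ?_⟩
  intro σ hσ v hv
  have : Submodule.map₂ f (Subalgebra.toSubmodule O) L ≤
      (Submodule.map₂ f (Subalgebra.toSubmodule O) L).comap (σ.restrictScalars 𝒪[F]) := by
    rw [Submodule.map₂_le]
    intro τ hτ w hw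
    exact Submodule.apply_mem_map₂ f (m := σ * τ) (O.mul_mem hσ hτ) hw
  exact this hv

end Orders

/-! ### Almost modular lattices. -/

section Good

variable {F : Type*} [Field F] [ValuativeRel F] [TopologicalSpace F]
  [IsNonarchimedeanLocalField F] {V : Type*} [AddCommGroup V] [Module F V] [FiniteDimensional F V]
  {b : LinearMap.BilinForm F V} {p : Fˣ}

-- If `pΛ = Λ`, then `Λ` absorbs all denominators and is all of `V`. But a finitely generated module
-- has bounded coordinates.
omit [TopologicalSpace F] [IsNonarchimedeanLocalField F] in
theorem IsUniformizer.smul_lt (hp : IsUniformizer p) [Nontrivial V]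
    (Λ : Submodule 𝒪[F] V) [hΛ : Submodule.IsLattice F Λ] : p • Λ < Λ := by
  refine lt_of_le_of_ne (units_smul_le_of_mem hp.mem Λ) fun h => ?_
  have hpow : ∀ n : ℕ, p ^ n • Λ = Λ := by
    intro n
    induction n with
    | zero => rw [pow_zero, one_smul]
    | succ n ih => rw [pow_succ, mul_smul, h, ih]
  have hF : ∀ (c : F) {x : V}, x ∈ Λ → c • x ∈ Λ := by
    intro c x hx
    obtain ⟨n, hn⟩ := hp.exists_pow_mul_mem c
    rw [← hpow n, mem_units_smul_iff] at hx
    have := smul_mem_of_mem hn hx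
    rw [smul_smul] at this
    convert this using 2
    have := p.ne_zero
    push_cast
    field_simp
  have htop : ∀ x : V, x ∈ Λ := by
    intro x
    obtain ⟨n, hn⟩ := hp.exists_pow_smul_mem Λ x
    have := hF ((p : F) ^ n)⁻¹ hn
    rwa [inv_smul_smul₀ (pow_ne_zero n p.ne_zero)] at this
  let e := Module.finBasis F V
  have : Nonempty (Fin (Module.finrank F V)) := ⟨⟨0, Module.finrank_pos⟩⟩
  let i := Classical.arbitrary (Fin (Module.finrank F V))
  have hL : Submodule.IsLattice F (Submodule.span 𝒪[F] (Set.range e)) :=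
    ⟨Submodule.fg_span (Set.finite_range _), by
      rw [Submodule.span_span_of_tower, e.span_eq]⟩
  obtain ⟨n, hn⟩ := hp.exists_pow_smul_le (Submodule.span 𝒪[F] (Set.range e)) hΛ.fg
  rw [hpow] at hn
  have hcoord : ∀ x ∈ Submodule.span 𝒪[F] (Set.range e), e.repr x i ∈ 𝒪[F] := by
    intro x hx
    induction hx using Submodule.span_induction with
    | mem x h =>
      obtain ⟨j, rfl⟩ := h
      rw [Module.Basis.repr_self, Finsupp.single_apply]
      split_ifs
      · exact one_mem _
      · exact zero_mem _
    | zero => simp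
    | add x y _ _ hx hy => simpa using add_mem hx hy
    | smul r x _ hx =>
      have : e.repr (r • x) i = (r : F) * e.repr x i := by
        change e.repr ((r : F) • x) i = _
        simp
      rw [this]
      exact mul_mem r.2 hx
  have := hcoord _ (hn (htop ((p : F)⁻¹ • e i)))
  exact hp.inv_notMem (by simpa using this)

/-- A lattice `Λ` with `p N ⊊ Λ ⊆ N` for some multiple `N` of its dual. -/
def IsAlmostModular (b : LinearMap.BilinForm F V) (p : Fˣ) (Λ : Submodule 𝒪[F] V) : Prop :=
  ∃ a : Fˣ, p • a • dualLattice b Λ < Λ ∧ Λ ≤ a • dualLattice b Λ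

-- Normalizes a lattice `M` by scaling so that it lies in `N` and meets the complement of `pN`.
omit [TopologicalSpace F] [IsNonarchimedeanLocalField F] in
theorem IsUniformizer.exists_smul_le_not_le (hp : IsUniformizer p) [Nontrivial V]
    (M N : Submodule 𝒪[F] V) [hM : Submodule.IsLattice F M] [hN : Submodule.IsLattice F N] :
    ∃ c : Fˣ, c • M ≤ N ∧ ¬ c • M ≤ p • N := by
  classical
  obtain ⟨k, hk⟩ := hp.exists_pow_smul_le M hN.fg
  -- Starting from `p^(-(k+1))M`, which is too large to fit in `N` because `p^k N ≤ M`, makes the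
  -- least exponent positive; its predecessor then witnesses the second condition.
  have hM' : ∃ n : ℕ, p ^ n • (p ^ (k + 1))⁻¹ • M ≤ N := hp.exists_pow_smul_le N (by
    exact (Submodule.IsLattice.smul F M _).fg)
  have h0 : Nat.find hM' ≠ 0 := by
    intro h
    have := Nat.find_spec hM'
    rw [h, pow_zero, one_smul, ← units_smul_le_smul_iff (c := p ^ (k + 1)), smul_inv_smul] at this
    have h2 := hk.trans this
    rw [pow_succ, mul_smul, units_smul_le_smul_iff] at h2
    exact (hp.smul_lt N).not_ge h2
  obtain ⟨m, hm⟩ := Nat.exists_eq_succ_of_ne_zero h0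
  refine ⟨p ^ Nat.find hM' * (p ^ (k + 1))⁻¹, ?_, ?_⟩
  · rw [mul_smul]; exact Nat.find_spec hM'
  · rw [mul_smul, hm, Nat.succ_eq_add_one, pow_succ', mul_smul, units_smul_le_smul_iff]
    exact Nat.find_min hM' (by omega)

/-- The lattices on which `End(Λ) ∩ End(Λ^♯)` acts. -/
theorem IsAlmostModular.eq_smul_or_eq_smul (hp : IsUniformizer p)
    (hdim : Module.finrank F V = 2) (hb : b.Nondegenerate) (hs : b.IsSymm)
    {Λ : Submodule 𝒪[F] V} [hΛ : Submodule.IsLattice F Λ] (h : IsAlmostModular b p Λ)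
    {M : Submodule 𝒪[F] V} [hM : Submodule.IsLattice F M] (hle : pairOrder b Λ ≤ endLattice M) :
    ∃ c : Fˣ, M = c • Λ ∨ M = c • dualLattice b Λ := by
  have : Nontrivial V := Module.nontrivial_of_finrank_pos (R := F) (by omega)
  obtain ⟨a, h1, h2⟩ := h
  have hd := isLattice_dualLattice hb Λ
  let N := a • dualLattice b Λ
  have hN : Submodule.IsLattice F N := Submodule.IsLattice.smul F _ a
  obtain ⟨c, hc, hc'⟩ := hp.exists_smul_le_not_le M N
  obtain ⟨m, hm, hm'⟩ := SetLike.not_le_iff_exists.mp hc'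
  -- By biduality, `m ∉ pN` gives `y ∈ N^♯` with `p⁻¹b(m, y)` nonintegral, so `b(m, y)` has an
  -- integral inverse.
  have hNN : dualLattice b (dualLattice b N) = N := dualLattice_dualLattice hb hs ⟨N, hN⟩
  rw [mem_units_smul_iff] at hm'
  change _ ∉ N at hm'
  rw [← hNN, mem_dualLattice] at hm'
  push Not at hm'
  obtain ⟨y, hy, hym⟩ := hm'
  rw [map_smul, LinearMap.smul_apply, smul_eq_mul] at hym
  have hui : (b m y)⁻¹ ∈ 𝒪[F] := by
    by_contra hu
    have := hp.dvd_inv _ hu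
    rw [inv_inv] at this
    exact hym this
  have hu0 : b m y ≠ 0 := by
    intro h0
    rw [h0, mul_zero] at hym
    exact hym (zero_mem _)
  have hbound : Λ ≤ c • M := by
    intro l hl
    -- A rank one map that sends `m` to `l` and `N` into `Λ`. As `Λ ⊆ N`, it preserves both
    -- lattices.
    let σ : Module.End F V := (b y).smulRight ((b m y)⁻¹ • l)
    have hσ : ∀ v ∈ N, σ v ∈ Λ := fun v hv =>
      smul_mem_of_mem (mem_dualLattice.mp hy v hv) (smul_mem_of_mem hui hl)
    have hσO : σ ∈ pairOrder b Λ := by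
      refine ⟨fun v hv => hσ v (h2 hv), ?_⟩
      rw [← endLattice_smul a]
      exact fun v hv => h2 (hσ v hv)
    have hσM : σ ∈ endLattice (c • M) := by
      rw [endLattice_smul]
      exact hle hσO
    have hσm : σ m = l := by
      change b y m • (b m y)⁻¹ • l = l
      rw [show b y m = b m y from hs.eq y m, smul_inv_smul₀ hu0]
    exact hσm ▸ hσM m hm
  obtain h3 | h3 := hp.eq_or_eq_of_le hdim h1 hbound hc
  · exact ⟨c⁻¹, Or.inl (by rw [← h3, inv_smul_smul])⟩
  · exact ⟨c⁻¹ * a, Or.inr (by rw [mul_smul, ← h3, inv_smul_smul])⟩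

/-- A lattice that is maximal among the integral lattices with an action of a given `‡`-stable
ring is almost modular. -/
theorem isAlmostModular_of_maximal (hp : IsUniformizer p) [Nontrivial V]
    (hb : b.Nondegenerate) (hs : b.IsSymm) {O : Subalgebra 𝒪[F] (Module.End F V)}
    (hO : ∀ σ ∈ O, dagger b hb σ ∈ O) {Λ : Submodule 𝒪[F] V} [hΛ : Submodule.IsLattice F Λ]
    (hOΛ : O ≤ endLattice Λ) {a : Fˣ} (ha : Λ ≤ a • dualLattice b Λ)
    (hmax : ∀ Λ' : Submodule 𝒪[F] V, Submodule.IsLattice F Λ' → O ≤ endLattice Λ' → Λ ≤ Λ' →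
      Λ' ≤ a • dualLattice b Λ' → Λ = Λ') : IsAlmostModular b p Λ := by
  classical
  have hd := isLattice_dualLattice hb Λ
  let N := a • dualLattice b Λ
  have hN : Submodule.IsLattice F N := Submodule.IsLattice.smul F _ a
  have hON : O ≤ endLattice N := by
    change O ≤ endLattice (a • dualLattice b Λ)
    rw [endLattice_smul]
    exact (le_pairOrder hb hs hO hOΛ).trans inf_le_right
  have hpair : ∀ x ∈ N, ∀ y ∈ Λ, (a : F)⁻¹ * b x y ∈ 𝒪[F] := by
    intro x hx y hy
    have := mem_dualLattice.mp (mem_units_smul_iff.mp hx) y hy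
    simpa using this
  have hex : ∃ n : ℕ, p ^ n • N ≤ Λ := hp.exists_pow_smul_le Λ hN.fg
  have hpN : p • N ≤ Λ := by
    by_contra hnot
    have hgt : 1 < Nat.find hex := by
      rw [Nat.lt_find_iff]
      intro n hn
      interval_cases n
      · intro h
        rw [pow_zero, one_smul] at h
        exact hnot ((units_smul_le_of_mem hp.mem N).trans h)
      · rwa [pow_one]
    -- With `k + 2` the least exponent, `Λ + p^(k+1)N` is still integral and `O`-stable. The new
    -- products lie in `p^(2k+2) b(N, N)`, and `p^(2k+2)N ⊆ p^(k+2)N ⊆ Λ` pairs with `N` into `a𝔬`.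
    -- Maximality then contradicts the choice of exponent.
    obtain ⟨k, hk⟩ : ∃ k, Nat.find hex = k + 2 := ⟨Nat.find hex - 2, by omega⟩
    have hspec := Nat.find_spec hex
    rw [hk] at hspec
    have hmin : ¬ p ^ (k + 1) • N ≤ Λ := Nat.find_min hex (by omega)
    have hpN' : p ^ (k + 1) • N ≤ N := units_smul_le_of_mem (by
      rw [Units.val_pow_eq_pow_val]; exact pow_mem hp.mem _) N
    refine hmin ?_
    have hnn : ∀ x ∈ p ^ (k + 1) • N, ∀ y ∈ p ^ (k + 1) • N, (a : F)⁻¹ * b x y ∈ 𝒪[F] := by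
      intro x hx y hy
      rw [mem_units_smul_iff] at hx hy
      have h1 : (p : F) ^ (k + 1) • y ∈ Λ := by
        have h2 : (p : F) ^ (k + 2) • (((p ^ (k + 1) : Fˣ) : F)⁻¹ • y) ∈ Λ := by
          refine hspec ?_
          rw [mem_units_smul_iff]
          simpa using hy
        have h3 := smul_mem_of_mem (pow_mem hp.mem k) h2
        rw [smul_smul, smul_smul] at h3
        convert h3 using 2
        have := p.ne_zero
        push_cast
        field_simp
        ring
      have h4 := hpair _ hx _ h1
      simp only [map_smul, LinearMap.smul_apply, smul_eq_mul] at h4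
      convert h4 using 1
      have := p.ne_zero
      push_cast
      field_simp
    have hΛN : ∀ x ∈ Λ, ∀ y ∈ N, (a : F)⁻¹ * b x y ∈ 𝒪[F] := fun x hx y hy => by
      rw [show b x y = b y x from hs.eq x y]
      exact hpair y hy x hx
    have hL : Submodule.IsLattice F (p ^ (k + 1) • N) := Submodule.IsLattice.smul F _ _
    have heq := hmax (Λ ⊔ p ^ (k + 1) • N) inferInstance ?_ le_sup_left ?_
    · exact le_sup_right.trans heq.ge
    · intro σ hσ v hv
      obtain ⟨l, hl, n, hn, rfl⟩ := Submodule.mem_sup.mp hv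
      rw [map_add]
      refine add_mem (Submodule.mem_sup_left (hOΛ hσ l hl)) (Submodule.mem_sup_right ?_)
      rw [← endLattice_smul (p ^ (k + 1))] at hON
      exact hON hσ n hn
    · rw [le_smul_dualLattice_iff]
      intro x hx y hy
      obtain ⟨l, hl, n, hn, rfl⟩ := Submodule.mem_sup.mp hx
      obtain ⟨l', hl', n', hn', rfl⟩ := Submodule.mem_sup.mp hy
      simp only [map_add, LinearMap.add_apply, mul_add]
      exact add_mem (add_mem (hpair l (ha hl) l' hl') (hpair n (hpN' hn) l' hl'))
        (add_mem (hΛN l hl n' (hpN' hn')) (hnn n hn n' hn'))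
  obtain h | h := hpN.lt_or_eq
  · exact ⟨a, h, ha⟩
  -- If `pN = Λ`, then `Λ` is modular for the scalar `pa`: it equals the new `N`, and `pΛ < Λ` is
  -- strict.
  · refine ⟨p * a, ?_, ?_⟩
    · rw [mul_smul]
      change p • (p • N) < Λ
      rw [h]
      exact hp.smul_lt Λ
    · rw [mul_smul]
      exact h.ge

end Good

/-! ### Maximal lattices and maximal `‡`-orders. -/

section Maximal

variable {F : Type*} [Field F] [ValuativeRel F] [TopologicalSpace F]
  [IsNonarchimedeanLocalField F] {V : Type*} [AddCommGroup V] [Module F V] [FiniteDimensional F V]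
  {b : LinearMap.BilinForm F V} {p : Fˣ}

omit [TopologicalSpace F] [IsNonarchimedeanLocalField F] [FiniteDimensional F V] in
theorem normIdeal_le_span_iff {Λ : Submodule 𝒪[F] V} {a : Fˣ} :
    normIdeal b Λ ≤ Submodule.span 𝒪[F] {(a : F)} ↔ ∀ x ∈ Λ, (a : F)⁻¹ * b x x ∈ 𝒪[F] := by
  rw [normIdeal, Submodule.span_le, Set.image_subset_iff]
  refine forall₂_congr fun x _ => ?_
  rw [Set.mem_preimage, SetLike.mem_coe, Submodule.mem_span_singleton]
  constructor
  · rintro ⟨r, hr⟩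
    have hr' : (r : F) * a = b x x := hr
    rw [← hr', mul_comm, mul_assoc, mul_inv_cancel₀ a.ne_zero, mul_one]
    exact r.2
  · intro h
    refine ⟨⟨_, h⟩, ?_⟩
    change (a : F)⁻¹ * b x x * a = b x x
    rw [mul_comm, mul_inv_cancel_left₀ a.ne_zero]

omit [FiniteDimensional F V] in
/-- In the definition of maximal lattices, fractional ideals may be given by generators. -/
theorem exists_isMaximalAt_iff {Λ : Submodule 𝒪[F] V} :
    (∃ 𝔞 : FractionalIdeal (nonZeroDivisors 𝒪[F]) F,
      𝔞 ≠ 0 ∧ IsMaximalAt b (𝔞 : Submodule 𝒪[F] F) Λ) ↔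
    ∃ a : Fˣ, IsMaximalAt b (Submodule.span 𝒪[F] {(a : F)}) Λ := by
  constructor
  · rintro ⟨𝔞, h0, h⟩
    have hpr : (𝔞 : Submodule 𝒪[F] F).IsPrincipal := inferInstance
    obtain ⟨x, hx⟩ := hpr.principal
    have hx0 : x ≠ 0 := by
      rintro rfl
      refine h0 (FractionalIdeal.coeToSubmodule_injective ?_)
      simpa using hx
    exact ⟨Units.mk0 x hx0, hx ▸ h⟩
  · rintro ⟨a, h⟩
    refine ⟨FractionalIdeal.spanSingleton _ (a : F), ?_, ?_⟩
    · rw [FractionalIdeal.spanSingleton_ne_zero_iff]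
      exact a.ne_zero
    · rwa [FractionalIdeal.coe_spanSingleton]

/-- The norm and the scale of each `𝔬`-submodule of `V` agree. -/
def NormEqScale (b : LinearMap.BilinForm F V) : Prop :=
  ∀ (Λ : Submodule 𝒪[F] V) (a : Fˣ),
    normIdeal b Λ ≤ Submodule.span 𝒪[F] {(a : F)} ↔ Λ ≤ a • dualLattice b Λ

theorem normEqScale (hchar : (2 : F) ≠ 0) (hdim : Module.finrank F V = 2)
    (hb : b.Nondegenerate) (hs : b.IsSymm)
    (hF : (2 : 𝒪[F]) ∉ 𝓂[F] ∨
      quadraticDefectSet (-(discDagger b hb) ∩ {x : F | x ∈ 𝒪[F]}) = maxIdeal F) :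
    NormEqScale b := by
  intro Λ a
  rw [normIdeal_le_span_iff, le_smul_dualLattice_iff]
  refine ⟨fun h x hx y hy => ?_, fun h x hx => h x hx x hx⟩
  exact inv_mul_bilin_mem hchar hdim hb hs hF (h x hx) (h y hy) (h _ (add_mem hx hy))

theorem exists_isMaximalAt_iff_isAlmostModular (hp : IsUniformizer p)
    (hdim : Module.finrank F V = 2) (hb : b.Nondegenerate) (hs : b.IsSymm)
    (hns : NormEqScale b) {Λ : Submodule 𝒪[F] V} [hΛ : Submodule.IsLattice F Λ] :
    (∃ 𝔞 : FractionalIdeal (nonZeroDivisors 𝒪[F]) F,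
      𝔞 ≠ 0 ∧ IsMaximalAt b (𝔞 : Submodule 𝒪[F] F) Λ) ↔ IsAlmostModular b p Λ := by
  have : Nontrivial V := Module.nontrivial_of_finrank_pos (R := F) (by omega)
  rw [exists_isMaximalAt_iff]
  constructor
  · rintro ⟨a, h1, h2⟩
    rw [hns] at h1
    -- The scalars act on every lattice, so `O = ⊥` imposes no stability condition.
    refine isAlmostModular_of_maximal hp hb hs (O := ⊥) ?_ bot_le h1
      fun Λ' hΛ' _ hle h => h2 Λ' hΛ' hle ((hns Λ' a).mpr h)
    intro σ hσ
    obtain ⟨r, rfl⟩ := Algebra.mem_bot.mp hσ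
    rw [dagger_eq_of_forall hb (τ := algebraMap 𝒪[F] (Module.End F V) r)]
    · exact hσ
    · intro v w
      change b v ((r : F) • w) = b ((r : F) • v) w
      simp
  · rintro ⟨a, h1, h2⟩
    refine ⟨a, (hns Λ a).mpr h2, fun Λ' hΛ' hle h => ?_⟩
    have h' := (hns Λ' a).mp h
    have hle' : a • dualLattice b Λ' ≤ a • dualLattice b Λ :=
      units_smul_le_smul_iff.mpr (dualLattice_anti hle)
    obtain h3 | h3 := hp.eq_or_eq_of_le hdim h1 hle (h'.trans hle')
    · exact h3.symm
    -- If `Λ' = aΛ^♯`, then dualizing gives `aΛ'^♯ = Λ`, and integrality of `Λ'` reads `Λ' ≤ Λ`.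
    · refine le_antisymm hle ?_
      have h4 : Λ' ≤ a • dualLattice b Λ' := h'
      have h5 : dualLattice b Λ' = a⁻¹ • Λ := by
        rw [h3, dualLattice_smul, dualLattice_dualLattice hb hs ⟨Λ, hΛ⟩]
      rwa [h5, smul_inv_smul] at h4

/-- Each `‡`-order acts on an almost modular lattice. -/
theorem IsDaggerOrder.exists_isAlmostModular (hp : IsUniformizer p) [Nontrivial V]
    {hb : b.Nondegenerate} (hs : b.IsSymm) {O : Subalgebra 𝒪[F] (Module.End F V)}
    (hO : IsDaggerOrder b hb O) : ∃ Λ : Submodule 𝒪[F] V,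
      Submodule.IsLattice F Λ ∧ IsAlmostModular b p Λ ∧ O ≤ endLattice Λ := by
  obtain ⟨L, hL, hOL⟩ := hO.1.exists_le_endLattice
  obtain ⟨a, ha⟩ := exists_le_smul_dualLattice hb hp L
  have hd := isLattice_dualLattice hb L
  let N := a • dualLattice b L
  have hN : Submodule.IsLattice F N := Submodule.IsLattice.smul F _ a
  -- Every integral lattice above `L` lies in `N = aL^♯`, since duality reverses inclusions. The
  -- search for a maximal one thus takes place in a Noetherian module.
  let S : Set (Submodule 𝒪[F] N) := {T | L ≤ T.map N.subtype ∧
    O ≤ endLattice (T.map N.subtype) ∧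
    T.map N.subtype ≤ a • dualLattice b (T.map N.subtype)}
  have hlift : ∀ Λ : Submodule 𝒪[F] V, L ≤ Λ → Λ ≤ a • dualLattice b Λ →
      (Λ.comap N.subtype).map N.subtype = Λ := by
    intro Λ h1 h2
    rw [Submodule.map_comap_subtype, inf_eq_right]
    exact h2.trans (units_smul_le_smul_iff.mpr (dualLattice_anti h1))
  have hmemS : ∀ Λ : Submodule 𝒪[F] V, L ≤ Λ → O ≤ endLattice Λ → Λ ≤ a • dualLattice b Λ →
      Λ.comap N.subtype ∈ S := by
    intro Λ h1 h2 h3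
    change _ ∧ _ ∧ _
    rw [hlift Λ h1 h3]
    exact ⟨h1, h2, h3⟩
  obtain ⟨T, ⟨hT1, hT2, hT3⟩, hT⟩ := set_has_maximal_iff_noetherian.mpr
    (inferInstance : IsNoetherian 𝒪[F] N) S ⟨_, hmemS L le_rfl hOL ha⟩
  have hTl : Submodule.IsLattice F (T.map N.subtype) :=
    Submodule.IsLattice.of_le_of_isLattice_of_fg F hT1
      ((IsNoetherian.noetherian T).map N.subtype)
  refine ⟨_, hTl, isAlmostModular_of_maximal hp hb hs (fun σ hσ => hO.dagger_mem hσ) hT2 hT3 ?_,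
    hT2⟩
  intro Λ' hΛ' h1 h2 h3
  by_contra hne
  refine hT _ (hmemS Λ' (hT1.trans h2) h1 h3) (lt_of_le_of_ne ?_ ?_)
  · rw [← Submodule.map_le_iff_le_comap]
    exact h2
  · rintro heq
    refine hne ?_
    rw [heq]
    exact hlift Λ' (hT1.trans h2) h3

/-- A larger `‡`-order acts on some lattice, which the smaller order also preserves. That lattice is
a multiple of `Λ` or `Λ^♯`, so the larger order lies in `pairOrder b Λ`. -/
theorem IsAlmostModular.maximal_pairOrder (hp : IsUniformizer p)
    (hdim : Module.finrank F V = 2) (hb : b.Nondegenerate) (hs : b.IsSymm)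
    {Λ : Submodule 𝒪[F] V} [hΛ : Submodule.IsLattice F Λ] (h : IsAlmostModular b p Λ) :
    Maximal (IsDaggerOrder b hb) (pairOrder b Λ) := by
  refine ⟨isDaggerOrder_pairOrder hb hs Λ, fun O hO hle => ?_⟩
  obtain ⟨M, hM, hOM⟩ := hO.1.exists_le_endLattice
  have hOM' := le_pairOrder hb hs (fun σ hσ => hO.dagger_mem hσ) hOM
  obtain ⟨c, rfl | rfl⟩ := h.eq_smul_or_eq_smul hp hdim hb hs (hle.trans hOM)
  · rwa [pairOrder_smul] at hOM'
  · rwa [pairOrder_smul, pairOrder_dualLattice hb hs] at hOM'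

end Maximal

end DaggerOrders

/-! ### The bijection. -/

theorem mainTheorem6 {F : Type*} [Field F] [ValuativeRel F] [TopologicalSpace F]
    [IsNonarchimedeanLocalField F] (hchar : (2 : F) ≠ 0)
    {V : Type*} [AddCommGroup V] [Module F V] [FiniteDimensional F V]
    (hdim : Module.finrank F V = 2)
    (b : LinearMap.BilinForm F V) (hb : b.Nondegenerate) (hs : b.IsSymm)
    (hF : (2 : 𝒪[F]) ∉ 𝓂[F] ∨
      DaggerOrders.quadraticDefectSet
        (-(DaggerOrders.discDagger b hb) ∩ {x : F | x ∈ 𝒪[F]}) = DaggerOrders.maxIdeal F) :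
    ∃ φ : Quotient (DaggerOrders.maximalLatticeSetoid b hb hs) →
        DaggerOrders.MaximalDaggerOrder b hb,
      (∀ Λ : DaggerOrders.MaximalLattice b,
        (φ (Quotient.mk (DaggerOrders.maximalLatticeSetoid b hb hs) Λ)).1 =
          DaggerOrders.endLattice Λ.1.1 ⊓
            DaggerOrders.endLattice (DaggerOrders.dualLattice b Λ.1.1)) ∧
      Function.Bijective φ := by
  obtain ⟨p, hp, -⟩ := DaggerOrders.exists_isUniformizer F
  have : Nontrivial V := Module.nontrivial_of_finrank_pos (R := F) (by omega)
  have hns := DaggerOrders.normEqScale hchar hdim hb hs hF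
  have hmod : ∀ Λ : DaggerOrders.MaximalLattice b, DaggerOrders.IsAlmostModular b p Λ.1.1 :=
    fun Λ => have := Λ.1.2
      (DaggerOrders.exists_isMaximalAt_iff_isAlmostModular hp hdim hb hs hns).mp Λ.2
  let f : DaggerOrders.MaximalLattice b → DaggerOrders.MaximalDaggerOrder b hb := fun Λ =>
    ⟨DaggerOrders.pairOrder b Λ.1.1, have := Λ.1.2
      (hmod Λ).maximal_pairOrder hp hdim hb hs⟩
  have hf : ∀ Λ M : DaggerOrders.MaximalLattice b,
      DaggerOrders.LatticeRel b Λ.1 M.1 → f Λ = f M := by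
    rintro Λ M ⟨c, h | h⟩
    all_goals
      have := M.1.2
      refine Subtype.ext ?_
      change DaggerOrders.pairOrder b Λ.1.1 = DaggerOrders.pairOrder b M.1.1
      rw [h, DaggerOrders.pairOrder_smul]
    rw [DaggerOrders.pairOrder_dualLattice hb hs]
  refine ⟨Quotient.lift f hf, fun Λ => rfl, ?_, ?_⟩
  · intro x y
    induction x using Quotient.inductionOn with | _ M
    induction y using Quotient.inductionOn with | _ Λ
    intro h
    have := Λ.1.2
    have := M.1.2
    have h' : DaggerOrders.pairOrder b M.1.1 = DaggerOrders.pairOrder b Λ.1.1 :=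
      congrArg Subtype.val h
    -- The common order acts on `M`, so `M` is a multiple of `Λ` or of its dual.
    exact Quotient.sound ((hmod Λ).eq_smul_or_eq_smul hp hdim hb hs (h'.ge.trans inf_le_left))
  · intro O
    obtain ⟨Λ, hΛ, hΛm, hO⟩ := O.2.prop.exists_isAlmostModular hp hs
    let M : DaggerOrders.MaximalLattice b := ⟨⟨Λ, hΛ⟩,
      (DaggerOrders.exists_isMaximalAt_iff_isAlmostModular hp hdim hb hs hns).mpr hΛm⟩
    refine ⟨Quotient.mk _ M, Subtype.ext ?_⟩
    have hle := DaggerOrders.le_pairOrder hb hs (fun σ hσ => O.2.prop.dagger_mem hσ) hO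
    -- Maximality of `O` turns its inclusion in the order of `Λ` into equality.
    exact (O.2.eq_of_le (DaggerOrders.isDaggerOrder_pairOrder hb hs Λ) hle).symm
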